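/- Let $M$ be a smooth finite-dimensional manifold on which a group $G$ acts by diffeomorphisms; $G$ acts on the right on the de Rham complex $\Omega(M)$ by pullback. For a right $G$-module $A$ let $C^p(G,A)$ be the space of maps $G^p\to A$ with $$(Df)(g_1,\dots,g_{p+1})=f(g_2,\dots,g_{p+1})+\sum_{i=1}^p(-1)^if(g_1,\dots,g_ig_{i+1},\dots,g_{p+1})+(-1)^{p+1}f(g_1,\dots,g_p)g_{p+1},$$ and let $H^p(G,A)$ be its cohomology. On the double complex $C^p(G,\Omega^q(M))$ put $\delta'=D$, $\delta''=(-1)^pd$, $\delta=\delta'+\delta''$, let $H^n(G,M,\Omega(M))$ be the cohomology of the total complex, and for a closed $G$-invariant form $\omega$ let $h(\omega)$ be its class there. Let $F_s=\bigoplus_{p\ge s}C^p(G,\Omega(M))$ be the first filtration, $h_s:H^n(F_s)\to H^n(G,M,\Omega(M))$ the map induced by inclusion, and $E_r^{s,q}=Z_r^s/(Z_{r-1}^{s+1}+\delta Z_{r-1}^{s-r+1})$ (in total degree $s+q$, with $Z_r^s=\{x\in F_s:\delta x\in F_{s+r}\}$) the terms of the spectral sequence of this filtration. For $r>q+1$ every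 element of $Z_r^s$ of degree $s+q$ is a cocycle, which gives the natural homomorphism $\kappa_r: E_r^{s,q}\to E_\infty^{s,q}=\operatorname{Im}h_s/\operatorname{Im}h_{s+1}$. Let $\omega$ be an exact $G$-invariant $m$-form on $M$, and suppose that $p$ is the greatest integer with $h(\omega)\in\operatorname{Im}h_{p+1}$. Then: 1. The natural homomorphism $\kappa_{m-p+1}:E_{m-p+1}^{p+1,m-p-1}\to\operatorname{Im}h_{p+1}/\operatorname{Im}h_{p+2}$ (in degree $m$) is surjective, and it is an isomorphism if $2p<m$. In particular the image of $h(\omega)$ in $\operatorname{Im}h_{p+1}/\operatorname{Im}h_{p+2}$ is represented by (is the image under $\kappa_{m-p+1}$ of) an element of $E_{m-p+1}^{p+1,m-p-1}$. 2. If $m=p+1$ and $M$ is connected, then regarding real numbers as constant functions on $M$ gives an isomorphism $H^m(G,\mathbb R)\to E_2^{m,0}$, where $\mathbb R$ is the trivial $G$-module, and the image of $h(\omega)$ in $\operatorname{Im}h_m/\operatorname{Im}h_{m+1}$ is represented by a class in $H^m(G,\mathbb R)$: it is the image of such a class under the composite $H^m(G,\mathbb R)\cong E_2^{m,0}\to\operatorname{Im}h_m/\operatorname{Im}h_{m+1}$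 with $\kappa_2$. -/

import Mathlib

set_option linter.unusedSectionVars false
open scoped Manifold ContDiff Topology
noncomputable section
namespace GManifold
section Forms
variable {E : Type*} [NormedAddCommGroup E] [NormedSpace ℝ E]
  {M : Type*} [TopologicalSpace M] [ChartedSpace E M]

/-- Smoothness of the pullback `(L z)^* (a z)` of a variable alternating map along a variable
linear map. -/
theorem contDiffAt_compContinuousLinearMap {q : ℕ} {a : E → E [⋀^Fin q]→L[ℝ] ℝ}
    {L : E → E →L[ℝ] E} {y : E} (ha : ContDiffAt ℝ ∞ a y) (hL : ContDiffAt ℝ ∞ L y) :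
    ContDiffAt ℝ ∞ (fun z => (a z).compContinuousLinearMap (L z)) y := by
  let A : ContinuousMultilinearMap ℝ (fun _ : Fin q => E) ℝ →L[ℝ] E [⋀^Fin q]→L[ℝ] ℝ :=
    LinearMap.mkContinuous
      { toFun := fun f => ContinuousMultilinearMap.alternatization f
        map_add' := fun f g => map_add _ f g
        map_smul' := fun c f => by
          ext v
          simp [ContinuousMultilinearMap.alternatization_apply_apply, Finset.mul_sum,
            mul_smul_comm] } (Fintype.card (Equiv.Perm (Fin q))) (by
      intro f
      refine ContinuousAlternatingMap.opNorm_le_bound _ (by positivity) fun v => ?_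
      simp only [LinearMap.coe_mk, AddHom.coe_mk,
        ContinuousMultilinearMap.alternatization_apply_apply]
      refine (norm_sum_le _ _).trans ?_
      have h1 : ∀ σ ∈ (Finset.univ : Finset (Equiv.Perm (Fin q))),
          ‖Equiv.Perm.sign σ • f (v ∘ σ)‖ ≤ ‖f‖ * ∏ i, ‖v i‖ := by
        intro σ _
        have h2 : ‖Equiv.Perm.sign σ • f (v ∘ σ)‖ = ‖f (v ∘ σ)‖ := by
          rcases Int.units_eq_one_or (Equiv.Perm.sign σ) with h | h <;> simp [h]
        rw [h2]
        refine (f.le_opNorm _).trans (le_of_eq ?_)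
        congr 1
        exact Equiv.prod_comp σ (fun i => ‖v i‖)
      refine (Finset.sum_le_card_nsmul _ _ _ h1).trans (le_of_eq ?_)
      rw [nsmul_eq_mul, Finset.card_univ, mul_assoc])
  have key : (fun z => (a z).compContinuousLinearMap (L z)) = fun z =>
      ((Fintype.card (Equiv.Perm (Fin q)) : ℝ)⁻¹) •
        A ((ContinuousMultilinearMap.compContinuousLinearMapContinuousMultilinear ℝ
          (fun _ : Fin q => E) (fun _ : Fin q => E) ℝ (fun _ => L z))
          ((ContinuousAlternatingMap.toContinuousMultilinearMapLI (𝕜 := ℝ) (E := E) (F := ℝ)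
            (ι := Fin q)) (a z))) := by
    funext z
    ext v
    have hs : ∀ σ : Equiv.Perm (Fin q),
        Equiv.Perm.sign σ • (a z) (fun i => L z (v (σ i))) = (a z) (fun i => L z (v i)) := by
      intro σ
      have := (a z).toAlternatingMap.map_perm (fun i => L z (v i)) σ
      simp only [Function.comp_def, ContinuousAlternatingMap.coe_toAlternatingMap] at this
      rw [this, smul_smul, Int.units_mul_self, one_smul]
    have hA : ∀ f, A f = ContinuousMultilinearMap.alternatization f := fun f => rfl
    rw [ContinuousAlternatingMap.smul_apply, hA,
      ContinuousMultilinearMap.alternatization_apply_apply]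
    have h3 : ∀ σ : Equiv.Perm (Fin q), Equiv.Perm.sign σ •
        ((ContinuousMultilinearMap.compContinuousLinearMapContinuousMultilinear ℝ
          (fun _ : Fin q => E) (fun _ : Fin q => E) ℝ (fun _ => L z))
          ((ContinuousAlternatingMap.toContinuousMultilinearMapLI (𝕜 := ℝ) (E := E) (F := ℝ)
            (ι := Fin q)) (a z))) (v ∘ σ)
          = (a z) (fun i => L z (v i)) := fun σ => hs σ
    rw [Finset.sum_congr rfl fun σ _ => h3 σ, Finset.sum_const, Finset.card_univ,
      nsmul_eq_mul, smul_eq_mul, inv_mul_cancel_left₀ (by positivity)]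
    rfl
  rw [key]
  refine ContDiffAt.const_smul _ (A.contDiff.contDiffAt.comp y ?_)
  refine ContDiffAt.clm_apply ?_ ?_
  · exact (ContinuousMultilinearMap.contDiff _).contDiffAt.comp y (contDiffAt_pi.2 fun _ => hL)
  · exact (LinearIsometry.contDiff _).contDiffAt.comp y ha

variable (E M) in
/-- Differential `q`-forms on `M`, not necessarily smooth. -/
abbrev FormField (q : ℕ) : Type _ :=
  ∀ x : M, TangentSpace 𝓘(ℝ, E) x [⋀^Fin q]→L[ℝ] ℝ

/-- The pullback of a form on `M` along a map `f : E → M`. -/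
def pull {q : ℕ} (f : E → M) (α : FormField E M q) (y : E) : E [⋀^Fin q]→L[ℝ] ℝ :=
  (α (f y)).compContinuousLinearMap (mfderiv 𝓘(ℝ, E) 𝓘(ℝ, E) f y)

/-- The pullback `g^* α` of a form along a map `g : M → M`. -/
def pullField {q : ℕ} (g : M → M) (α : FormField E M q) : FormField E M q := fun x =>
  (α (g x)).compContinuousLinearMap (mfderiv 𝓘(ℝ, E) 𝓘(ℝ, E) g x)

/-- A form is smooth if its coordinate expression in every chart of the atlas is smooth. -/
def IsSmoothForm {q : ℕ} (α : FormField E M q) : Prop :=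
  ∀ e ∈ atlas E M, ContDiffOn ℝ ∞ (pull e.symm α) e.target

/-- The exterior derivative of a form: at `x` it is the exterior derivative of the coordinate
expression in the preferred chart at `x`. By `extDeriv_pull` any other chart gives the same. -/
def dField {q : ℕ} (α : FormField E M q) : FormField E M (q + 1) := fun x =>
  (extDeriv (pull (chartAt E x).symm α) (chartAt E x x)).compContinuousLinearMap
    (mfderiv 𝓘(ℝ, E) 𝓘(ℝ, E) (chartAt E x) x)

theorem pull_add {q : ℕ} (f : E → M) (α β : FormField E M q) :
    pull f (α + β) = pull f α + pull f β := rfl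

theorem pull_smul {q : ℕ} (f : E → M) (c : ℝ) (α : FormField E M q) :
    pull f (c • α) = c • pull f α := rfl

theorem pullField_id {q : ℕ} (α : FormField E M q) : pullField id α = α := by
  funext x
  simp only [pullField, mfderiv_id]
  rfl

theorem pullField_comp {q : ℕ} {g h : M → M} (hg : MDifferentiable 𝓘(ℝ, E) 𝓘(ℝ, E) g)
    (hh : MDifferentiable 𝓘(ℝ, E) 𝓘(ℝ, E) h) (α : FormField E M q) :
    pullField (g ∘ h) α = pullField h (pullField g α) := by
  funext x
  simp only [pullField, mfderiv_comp x (hg (h x)) (hh x)]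
  rfl

theorem pull_pullField {q : ℕ} {g : M → M} {f : E → M} {y : E}
    (hg : MDifferentiable 𝓘(ℝ, E) 𝓘(ℝ, E) g) (hf : MDifferentiableAt 𝓘(ℝ, E) 𝓘(ℝ, E) f y)
    (α : FormField E M q) : pull f (pullField g α) y = pull (g ∘ f) α y := by
  simp only [pull, pullField, mfderiv_comp y (hg (f y)) hf]
  rfl

theorem contMDiffAt_chartAt_comp [IsManifold 𝓘(ℝ, E) ∞ M] {f : E → M} {y : E}
    (hf : ContMDiffAt 𝓘(ℝ, E) 𝓘(ℝ, E) ∞ f y) :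
    ContDiffAt ℝ ∞ (chartAt E (f y) ∘ f) y := by
  rw [← contMDiffAt_iff_contDiffAt]
  exact (contMDiffAt_of_mem_maximalAtlas (IsManifold.chart_mem_maximalAtlas (f y))
    (mem_chart_source E (f y))).comp y hf

theorem pull_eventuallyEq [IsManifold 𝓘(ℝ, E) ∞ M] {q : ℕ} {f : E → M} {y : E}
    (hf : ContMDiffAt 𝓘(ℝ, E) 𝓘(ℝ, E) ∞ f y) (α : FormField E M q) :
    pull f α =ᶠ[𝓝 y] fun z =>
      (pull (chartAt E (f y)).symm α ((chartAt E (f y) ∘ f) z)).compContinuousLinearMap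
        (fderiv ℝ (chartAt E (f y) ∘ f) z) := by
  set e := chartAt E (f y) with he
  have h1 : ∀ᶠ z in 𝓝 y, f z ∈ e.source :=
    hf.continuousAt.eventually_mem (e.open_source.mem_nhds (mem_chart_source E (f y)))
  have h2 : ∀ᶠ z in 𝓝 y, ContDiffAt ℝ 1 (e ∘ f) z :=
    ((contMDiffAt_chartAt_comp hf).of_le (by exact_mod_cast le_top)).eventually (by simp)
  filter_upwards [h1.eventually_nhds, h2] with z hz hz2
  have hz1 : f z ∈ e.source := hz.self_of_nhds
  have hfz : f =ᶠ[𝓝 z] e.symm ∘ (e ∘ f) := by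
    filter_upwards [hz] with w hw
    exact (e.left_inv hw).symm
  have hs : MDifferentiableAt 𝓘(ℝ, E) 𝓘(ℝ, E) e.symm ((e ∘ f) z) :=
    mdifferentiableAt_atlas_symm (chart_mem_atlas E (f y)) (e.map_source hz1)
  have hd : MDifferentiableAt 𝓘(ℝ, E) 𝓘(ℝ, E) (e ∘ f) z :=
    (hz2.differentiableAt (by simp)).mdifferentiableAt
  have h3 : pull f α z = pull (e.symm ∘ (e ∘ f)) α z := by
    have h4 := hfz.mfderiv_eq (I := 𝓘(ℝ, E)) (I' := 𝓘(ℝ, E))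
    have h5 : e.symm (e (f z)) = f z := e.left_inv hz1
    simp only [pull]
    rw [h4]
    simp only [Function.comp_apply]
    rw [h5]
    rfl
  rw [h3]
  simp only [pull]
  rw [mfderiv_comp z hs hd, mfderiv_eq_fderiv]
  rfl

theorem minSmoothness_two_le : minSmoothness ℝ 2 ≤ ∞ := by
  rw [minSmoothness_of_isRCLikeNormedField]
  exact WithTop.coe_le_coe.2 (le_top : (2 : ℕ∞) ≤ ⊤)

theorem extDeriv_pull [IsManifold 𝓘(ℝ, E) ∞ M] {q : ℕ} {f : E → M} {y : E}
    (hf : ContMDiffAt 𝓘(ℝ, E) 𝓘(ℝ, E) ∞ f y) {α : FormField E M q} (hα : IsSmoothForm α) :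
    extDeriv (pull f α) y = pull f (dField α) y := by
  have hs : ContDiffAt ℝ ∞ (pull (chartAt E (f y)).symm α) (chartAt E (f y) (f y)) :=
    (hα _ (chart_mem_atlas E (f y))).contDiffAt
      ((chartAt E (f y)).open_target.mem_nhds (mem_chart_target E (f y)))
  have hc := contMDiffAt_chartAt_comp hf
  have hd : DifferentiableAt ℝ (pull (chartAt E (f y)).symm α) ((chartAt E (f y) ∘ f) y) :=
    hs.differentiableAt (by simp)
  rw [(pull_eventuallyEq hf α).extDeriv_eq, extDeriv_pullback hd hc minSmoothness_two_le]
  have h1 : fderiv ℝ (chartAt E (f y) ∘ f) y =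
      (mfderiv 𝓘(ℝ, E) 𝓘(ℝ, E) (chartAt E (f y)) (f y)).comp
        (mfderiv 𝓘(ℝ, E) 𝓘(ℝ, E) f y) := by
    rw [← mfderiv_eq_fderiv]
    exact mfderiv_comp y (mdifferentiableAt_atlas (chart_mem_atlas E (f y))
      (mem_chart_source E (f y))) (hf.mdifferentiableAt (by simp))
  rw [h1]
  rfl

theorem contDiffAt_pull [IsManifold 𝓘(ℝ, E) ∞ M] {q : ℕ} {f : E → M} {y : E}
    (hf : ContMDiffAt 𝓘(ℝ, E) 𝓘(ℝ, E) ∞ f y) {α : FormField E M q} (hα : IsSmoothForm α) :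
    ContDiffAt ℝ ∞ (pull f α) y := by
  have hs : ContDiffAt ℝ ∞ (pull (chartAt E (f y)).symm α) (chartAt E (f y) (f y)) :=
    (hα _ (chart_mem_atlas E (f y))).contDiffAt
      ((chartAt E (f y)).open_target.mem_nhds (mem_chart_target E (f y)))
  have hc := contMDiffAt_chartAt_comp hf
  refine ContDiffAt.congr_of_eventuallyEq ?_ (pull_eventuallyEq hf α)
  exact contDiffAt_compContinuousLinearMap 
    (ContDiffAt.comp (g := pull (chartAt E (f y)).symm α) y hs hc) (hc.fderiv_right (by simp))

theorem contMDiffAt_symm_of_mem_atlas [IsManifold 𝓘(ℝ, E) ∞ M] {e : OpenPartialHomeomorph M E}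
    (he : e ∈ atlas E M) {y : E} (hy : y ∈ e.target) :
    ContMDiffAt 𝓘(ℝ, E) 𝓘(ℝ, E) ∞ e.symm y :=
  contMDiffAt_symm_of_mem_maximalAtlas (IsManifold.subset_maximalAtlas he) hy

theorem IsSmoothForm.dField [IsManifold 𝓘(ℝ, E) ∞ M] {q : ℕ} {α : FormField E M q}
    (hα : IsSmoothForm α) : IsSmoothForm (dField α) := by
  intro e he
  have h1 : ContDiffOn ℝ ∞ (extDeriv (pull e.symm α)) e.target := by
    intro y hy
    refine ContDiffAt.contDiffWithinAt ?_
    exact (ContinuousAlternatingMap.alternatizeUncurryFinCLM ℝ E ℝ).contDiff.contDiffAt.comp y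
      ((contDiffAt_pull (contMDiffAt_symm_of_mem_atlas he hy) hα).fderiv_right (m := ∞) le_rfl)
  exact h1.congr fun y hy => (extDeriv_pull (contMDiffAt_symm_of_mem_atlas he hy) hα).symm

theorem IsSmoothForm.pullField [IsManifold 𝓘(ℝ, E) ∞ M] {q : ℕ} {α : FormField E M q}
    (hα : IsSmoothForm α) {g : M → M} (hg : ContMDiff 𝓘(ℝ, E) 𝓘(ℝ, E) ∞ g) :
    IsSmoothForm (pullField g α) := by
  intro e he y hy
  have he' : ∀ z ∈ e.target, ContMDiffAt 𝓘(ℝ, E) 𝓘(ℝ, E) ∞ e.symm z :=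
    fun z hz => contMDiffAt_symm_of_mem_atlas he hz
  refine ContDiffWithinAt.congr
    (contDiffAt_pull ((hg (e.symm y)).comp y (he' y hy)) hα).contDiffWithinAt
    (fun z hz => ?_) ?_
  · exact pull_pullField (hg.mdifferentiable (by simp))
      ((he' z hz).mdifferentiableAt (by simp)) α
  · exact pull_pullField (hg.mdifferentiable (by simp))
      ((he' y hy).mdifferentiableAt (by simp)) α

theorem dField_add [IsManifold 𝓘(ℝ, E) ∞ M] {q : ℕ} {α β : FormField E M q}
    (hα : IsSmoothForm α) (hβ : IsSmoothForm β) : dField (α + β) = dField α + dField β := by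
  funext x
  have hy := contMDiffAt_symm_of_mem_atlas (M := M) (chart_mem_atlas E x) (mem_chart_target E x)
  simp only [dField, pull_add]
  rw [extDeriv_add ((contDiffAt_pull hy hα).differentiableAt (by simp))
    ((contDiffAt_pull hy hβ).differentiableAt (by simp))]
  rfl

theorem dField_smul {q : ℕ} (c : ℝ) (α : FormField E M q) :
    dField (c • α) = c • dField α := by
  funext x
  simp only [dField, pull_smul]
  rw [extDeriv_smul]
  rfl

theorem dField_dField [IsManifold 𝓘(ℝ, E) ∞ M] {q : ℕ} {α : FormField E M q}
    (hα : IsSmoothForm α) : dField (dField α) = 0 := by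
  funext x
  have h1 : pull (chartAt E x).symm (dField α) =ᶠ[𝓝 (chartAt E x x)]
      extDeriv (pull (chartAt E x).symm α) := by
    filter_upwards [(chartAt E x).open_target.mem_nhds (mem_chart_target E x)] with y hy
    exact (extDeriv_pull (contMDiffAt_symm_of_mem_atlas (chart_mem_atlas E x) hy) hα).symm
  have hy := contMDiffAt_symm_of_mem_atlas (M := M) (chart_mem_atlas E x) (mem_chart_target E x)
  rw [dField, h1.extDeriv_eq, extDeriv_extDeriv_apply (contDiffAt_pull hy hα)
    minSmoothness_two_le]
  rfl

theorem dField_pullField [IsManifold 𝓘(ℝ, E) ∞ M] {q : ℕ} {α : FormField E M q}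
    (hα : IsSmoothForm α) {g : M → M} (hg : ContMDiff 𝓘(ℝ, E) 𝓘(ℝ, E) ∞ g) :
    dField (pullField g α) = pullField g (dField α) := by
  funext x
  set e := chartAt E x with he
  have hes : ∀ z ∈ e.target, ContMDiffAt 𝓘(ℝ, E) 𝓘(ℝ, E) ∞ e.symm z :=
    fun z hz => contMDiffAt_symm_of_mem_atlas (chart_mem_atlas E x) hz
  have hx := mem_chart_target E x
  have h1 : pull e.symm (pullField g α) =ᶠ[𝓝 (e x)] pull (g ∘ e.symm) α := by
    filter_upwards [e.open_target.mem_nhds hx] with z hz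
    exact pull_pullField (hg.mdifferentiable (by simp))
      ((hes z hz).mdifferentiableAt (by simp)) α
  have h2 : dField (pullField g α) x = (extDeriv (pull e.symm (pullField g α))
    (e x)).compContinuousLinearMap (mfderiv 𝓘(ℝ, E) 𝓘(ℝ, E) e x) := rfl
  rw [h2, h1.extDeriv_eq, extDeriv_pull ((hg _).comp _ (hes _ hx)) hα,
    ← pull_pullField (hg.mdifferentiable (by simp)) ((hes _ hx).mdifferentiableAt (by simp))]
  have h3 : (mfderiv 𝓘(ℝ, E) 𝓘(ℝ, E) e.symm (e x)).comp (mfderiv 𝓘(ℝ, E) 𝓘(ℝ, E) e x)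
      = ContinuousLinearMap.id ℝ (TangentSpace 𝓘(ℝ, E) x) :=
    (mdifferentiable_of_mem_atlas (chart_mem_atlas E x)).symm_comp_deriv (mem_chart_source E x)
  have h4 : e.symm (e x) = x := e.left_inv (mem_chart_source E x)
  ext v
  have h5 : ∀ w : E, mfderiv 𝓘(ℝ, E) 𝓘(ℝ, E) e.symm (e x) (mfderiv 𝓘(ℝ, E) 𝓘(ℝ, E) e x w) = w :=
    fun w => congrArg (fun T => T w) h3
  have h6 : (fun i => mfderiv 𝓘(ℝ, E) 𝓘(ℝ, E) e.symm (e x)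
      (mfderiv 𝓘(ℝ, E) 𝓘(ℝ, E) e x (v i))) = v := funext fun i => h5 (v i)
  have h7 : ∀ z : M, z = x → ∀ u : Fin (q + 1) → E, u = v →
      (GManifold.pullField g (dField α) z : E [⋀^Fin (q + 1)]→L[ℝ] ℝ) u =
        (GManifold.pullField g (dField α) x : E [⋀^Fin (q + 1)]→L[ℝ] ℝ) v := by
    rintro z rfl u rfl
    rfl
  exact h7 _ h4 _ h6

end Forms
section Bundled
variable (E : Type*) [NormedAddCommGroup E] [NormedSpace ℝ E]
  (M : Type*) [TopologicalSpace M] [ChartedSpace E M] [IsManifold 𝓘(ℝ, E) ∞ M]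

/-- The subspace of smooth forms. -/
def smoothForms (q : ℕ) : Submodule ℝ (FormField E M q) where
  carrier := {α | IsSmoothForm α}
  zero_mem' := fun e _ => contDiffOn_const (c := (0 : E [⋀^Fin q]→L[ℝ] ℝ)) (s := e.target)
  add_mem' := fun ha hb e he => (ha e he).add (hb e he)
  smul_mem' := fun c _ ha e he => (ha e he).const_smul c

/-- The space `Ω^q(M)` of smooth differential `q`-forms on `M`. -/
def Form (q : ℕ) : Type _ := ↥(smoothForms E M q)

instance (q : ℕ) : AddCommGroup (Form E M q) := inferInstanceAs (AddCommGroup ↥(smoothForms E M q))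

instance (q : ℕ) : Module ℝ (Form E M q) := inferInstanceAs (Module ℝ ↥(smoothForms E M q))

variable {E M}

/-- The exterior derivative `d : Ω^q(M) → Ω^{q+1}(M)`. -/
def d {q : ℕ} : Form E M q →ₗ[ℝ] Form E M (q + 1) where
  toFun α := ⟨dField α.1, IsSmoothForm.dField α.2⟩
  map_add' α β := Subtype.ext (dField_add α.2 β.2)
  map_smul' c α := Subtype.ext (dField_smul c α.1)

theorem d_d {q : ℕ} (α : Form E M q) : d (d α) = 0 := Subtype.ext (dField_dField α.2)

/-- A form is exact if it is `d` of a form; the only exact `0`-form is `0`. -/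
def IsExact : ∀ {q : ℕ}, Form E M q → Prop
  | 0, α => α = 0
  | _ + 1, α => ∃ β, d β = α

theorem IsExact.d_eq_zero : ∀ {q : ℕ} {α : Form E M q}, IsExact α → d α = 0
  | 0, _, h => by
    have h' := h
    simp only [IsExact] at h'
    rw [h', map_zero]
  | _ + 1, _, ⟨β, h⟩ => by rw [← h, d_d]

/-- The pullback `g^* : Ω^q(M) → Ω^q(M)` along a smooth map `g : M → M`. -/
def pullback {q : ℕ} (g : M → M) (hg : ContMDiff 𝓘(ℝ, E) 𝓘(ℝ, E) ∞ g) :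
    Form E M q →ₗ[ℝ] Form E M q where
  toFun α := ⟨pullField g α.1, IsSmoothForm.pullField α.2 hg⟩
  map_add' _ _ := rfl
  map_smul' _ _ := rfl

/-- The constant function `c`, as a `0`-form. -/
def constForm : ℝ →ₗ[ℝ] Form E M 0 where
  toFun c := ⟨fun _ => ContinuousAlternatingMap.constOfIsEmpty ℝ _ (Fin 0) c,
    fun e _ => contDiffOn_const
      (c := ContinuousAlternatingMap.constOfIsEmpty ℝ E (Fin 0) c) (s := e.target)⟩
  map_add' _ _ := rfl
  map_smul' _ _ := rfl

theorem d_constForm (c : ℝ) : d (constForm c : Form E M 0) = 0 := by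
  apply Subtype.ext
  funext x
  have h : pull (chartAt E x).symm (constForm c : Form E M 0).1 =
      fun _ : E => ContinuousAlternatingMap.constOfIsEmpty ℝ E (Fin 0) c := rfl
  have h2 : extDeriv (pull (chartAt E x).symm (constForm c : Form E M 0).1) (chartAt E x x) = 0 := by
    rw [h, extDeriv, fderiv_const_apply]
    exact map_zero (ContinuousAlternatingMap.alternatizeUncurryFinCLM ℝ E ℝ)
  change dField (constForm c : Form E M 0).1 x = 0
  rw [dField, h2]
  rfl

theorem pullback_constForm (g : M → M) (hg : ContMDiff 𝓘(ℝ, E) 𝓘(ℝ, E) ∞ g) (c : ℝ) :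
    pullback g hg (constForm c : Form E M 0) = constForm c := rfl

variable (E M) in
/-- The group `G` acts on the manifold `M` by smooth maps (hence by diffeomorphisms). -/
class SmoothAction (G : Type*) [Group G] [MulAction G M] : Prop where
  contMDiff_smul : ∀ g : G, ContMDiff 𝓘(ℝ, E) 𝓘(ℝ, E) ∞ (fun x : M => g • x)

variable (E M) in
/-- The right `G`-module `Ω^q(M)`, where `g` acts by `α ↦ g^* α`. Right `G`-modules are
representations of the opposite group. -/
def formRep (G : Type*) [Group G] [MulAction G M] [SmoothAction E M G] (q : ℕ) :
    Representation ℝ Gᵐᵒᵖ (Form E M q) where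
  toFun g := pullback (fun x => g.unop • x) (SmoothAction.contMDiff_smul g.unop)
  map_one' := by
    refine LinearMap.ext fun α => Subtype.ext ?_
    have h : (fun x : M => (1 : Gᵐᵒᵖ).unop • x) = id := by
      funext x
      simp
    change pullField (fun x : M => (1 : Gᵐᵒᵖ).unop • x) α.1 = α.1
    rw [h, pullField_id]
  map_mul' g h := by
    refine LinearMap.ext fun α => Subtype.ext ?_
    have h1 : (fun x : M => (g * h).unop • x) =
        (fun x : M => h.unop • x) ∘ (fun x : M => g.unop • x) := by
      funext x
      simp [mul_smul]
    change pullField (fun x : M => (g * h).unop • x) α.1 =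
      pullField (fun x : M => g.unop • x) (pullField (fun x : M => h.unop • x) α.1)
    rw [h1, pullField_comp
      ((SmoothAction.contMDiff_smul (E := E) (M := M) h.unop).mdifferentiable (by simp))
      ((SmoothAction.contMDiff_smul (E := E) (M := M) g.unop).mdifferentiable (by simp))]

theorem d_formRep (G : Type*) [Group G] [MulAction G M] [SmoothAction E M G] {q : ℕ}
    (g : Gᵐᵒᵖ) (α : Form E M q) :
    d (formRep E M G q g α) = formRep E M G (q + 1) g (d α) :=
  Subtype.ext (dField_pullField α.2 (SmoothAction.contMDiff_smul g.unop))

end Bundled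

section GroupCohomology
variable {G : Type*} [Group G] {A : Type*} [AddCommGroup A] [Module ℝ A]

/-- The differential `D : C^p(G, A) → C^{p+1}(G, A)` on nonhomogeneous cochains with values in a
right `G`-module `A`:
`(D f)(g_1, …, g_{p+1}) = f(g_2, …, g_{p+1}) + ∑_{i=1}^p (-1)^i f(g_1, …, g_i g_{i+1}, …, g_{p+1})
  + (-1)^{p+1} f(g_1, …, g_p) g_{p+1}`. -/
def D (ρ : Representation ℝ Gᵐᵒᵖ A) (p : ℕ) :
    ((Fin p → G) → A) →ₗ[ℝ] ((Fin (p + 1) → G) → A) where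
  toFun f g := f (Fin.tail g) +
    ∑ i : Fin p, (-1 : ℝ) ^ ((i : ℕ) + 1) • f (Fin.contractNth i.castSucc (· * ·) g) +
    (-1 : ℝ) ^ (p + 1) • ρ (MulOpposite.op (g (Fin.last p))) (f (Fin.init g))
  map_add' f f' := by
    funext g
    simp only [Pi.add_apply, smul_add, Finset.sum_add_distrib, map_add]
    abel
  map_smul' c f := by
    funext g
    simp only [Pi.smul_apply, smul_add, Finset.smul_sum, map_smul, RingHom.id_apply,
      smul_comm c]

/-- The coboundaries in `C^p(G, A)`. -/
def groupCoboundaries (ρ : Representation ℝ Gᵐᵒᵖ A) : ∀ p : ℕ, Submodule ℝ ((Fin p → G) → A)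
  | 0 => ⊥
  | p + 1 => LinearMap.range (D ρ p)

/-- The cohomology `H^p(G, A)` of `G` with values in a right `G`-module `A`. -/
abbrev GroupCohomology (ρ : Representation ℝ Gᵐᵒᵖ A) (p : ℕ) : Type _ :=
  ↥(LinearMap.ker (D ρ p)) ⧸ (groupCoboundaries ρ p).submoduleOf (LinearMap.ker (D ρ p))

end GroupCohomology

section DoubleComplex
variable (E : Type*) [NormedAddCommGroup E] [NormedSpace ℝ E]
  (M : Type*) [TopologicalSpace M] [ChartedSpace E M] [IsManifold 𝓘(ℝ, E) ∞ M]
  (G : Type*) [Group G] [MulAction G M] [SmoothAction E M G]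

/-- Families `(c_{p,q})` with `c_{p,q} ∈ C^p(G, Ω^q(M))`. The groups of the double complex and of
its total complex are the subspaces of families supported in the relevant bidegrees. -/
abbrev Cochain : Type _ := ∀ p q : ℕ, (Fin p → G) → Form E M q

variable {E M G}

/-- The first differential `δ'`, which is `D : C^p(G, Ω^q(M)) → C^{p+1}(G, Ω^q(M))`. -/
def delta' : Cochain E M G →ₗ[ℝ] Cochain E M G where
  toFun c := fun
    | 0, _ => 0
    | p + 1, q => D (formRep E M G q) p (c p q)
  map_add' c c' := by
    funext p q
    cases p with
    | zero => simp
    | succ p => exact map_add (D (formRep E M G q) p) _ _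
  map_smul' a c := by
    funext p q
    cases p with
    | zero => simp
    | succ p => exact map_smul (D (formRep E M G q) p) _ _

/-- The second differential `δ''`, which is `(-1)^p d : C^p(G, Ω^q(M)) → C^p(G, Ω^{q+1}(M))`. -/
def delta'' : Cochain E M G →ₗ[ℝ] Cochain E M G where
  toFun c := fun
    | _, 0 => 0
    | p, q + 1 => fun g => (-1 : ℝ) ^ p • d (c p q g)
  map_add' c c' := by
    funext p q
    cases q with
    | zero => simp
    | succ q =>
      funext g
      simp
  map_smul' a c := by
    funext p q
    cases q with
    | zero => simp
    | succ q =>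
      funext g
      simp [smul_comm a]

/-- The total differential `δ = δ' + δ''`. -/
def delta : Cochain E M G →ₗ[ℝ] Cochain E M G := delta' + delta''

variable (E M G)

/-- The part `⊕_{p+q=n} C^p(G, Ω^q(M))` of degree `n` of the total complex `C^{**}(G, Ω(M))`. -/
def Tot (n : ℤ) : Submodule ℝ (Cochain E M G) where
  carrier := {c | ∀ p q : ℕ, (p : ℤ) + q ≠ n → c p q = 0}
  zero_mem' := fun _ _ _ => rfl
  add_mem' := fun ha hb p q h => by simp [ha p q h, hb p q h]
  smul_mem' := fun a _ hc p q h => by simp [hc p q h]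

/-- The first filtration `F_{1,s} = ⊕_{p ≥ s} C^p(G, Ω(M))`. -/
def Fil (s : ℤ) : Submodule ℝ (Cochain E M G) where
  carrier := {c | ∀ p q : ℕ, (p : ℤ) < s → c p q = 0}
  zero_mem' := fun _ _ _ => rfl
  add_mem' := fun ha hb p q h => by simp [ha p q h, hb p q h]
  smul_mem' := fun a _ hc p q h => by simp [hc p q h]

variable {E M G}

/-- The cocycles of degree `n` of a subcomplex `W` of the total complex. -/
def cocycles (W : Submodule ℝ (Cochain E M G)) (n : ℤ) : Submodule ℝ (Cochain E M G) :=
  Tot E M G n ⊓ W ⊓ LinearMap.ker delta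

/-- The coboundaries of degree `n` of a subcomplex `W` of the total complex. -/
def coboundaries (W : Submodule ℝ (Cochain E M G)) (n : ℤ) : Submodule ℝ (Cochain E M G) :=
  (Tot E M G (n - 1) ⊓ W).map delta

/-- The cohomology `H^n(W)` of a subcomplex `W` of the total complex. -/
abbrev Cohomology (W : Submodule ℝ (Cochain E M G)) (n : ℤ) : Type _ :=
  ↥(cocycles W n) ⧸ (coboundaries W n).submoduleOf (cocycles W n)

variable (E M G)

/-- The cohomology `H^n(G, M, Ω(M))` of the total complex. -/
abbrev TotalCohomology (n : ℤ) : Type _ := Cohomology (⊤ : Submodule ℝ (Cochain E M G)) n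

/-- The homomorphism `h_s : H^n(F_{1,s}) → H^n(G, M, Ω(M))` induced by the inclusion. -/
def hFil (s n : ℤ) : Cohomology (Fil E M G s) n →ₗ[ℝ] TotalCohomology E M G n :=
  Submodule.mapQ _ _
    (Submodule.inclusion (inf_le_inf_right _ (inf_le_inf_left _ le_top)))
    (by
      intro x hx
      exact Submodule.map_mono (inf_le_inf_left _ le_top) hx)

/-- The subspace `Im h_s` of `H^n(G, M, Ω(M))`. -/
def ImH (s n : ℤ) : Submodule ℝ (TotalCohomology E M G n) := LinearMap.range (hFil E M G s n)

/-- The graded piece `Im h_s / Im h_{s+1}` in degree `n`, that is `E_{1,∞}^{s,n-s}`. -/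
abbrev GradedPiece (s n : ℤ) : Type _ :=
  ↥(ImH E M G s n) ⧸ (ImH E M G (s + 1) n).submoduleOf (ImH E M G s n)

variable {E M G} in
/-- The image in `Im h_s / Im h_{s+1}` of a class lying in `Im h_s`. -/
def toGraded {s n : ℤ} (x : TotalCohomology E M G n) (hx : x ∈ ImH E M G s n) :
    GradedPiece E M G s n := Submodule.Quotient.mk ⟨x, hx⟩

/-- The elements of degree `n` of `F_{1,s}` whose differential lies in `F_{1,s+r}`. -/
def ZPage (r s n : ℤ) : Submodule ℝ (Cochain E M G) :=
  Tot E M G n ⊓ Fil E M G s ⊓ (Fil E M G (s + r)).comap delta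

/-- The subspace `Z_{r-1}^{s+1} + δ Z_{r-1}^{s-r+1}` of degree `n` by which `Z_r^s` is divided. -/
def BPage (r s n : ℤ) : Submodule ℝ (Cochain E M G) :=
  ZPage E M G (r - 1) (s + 1) n ⊔ (ZPage E M G (r - 1) (s - r + 1) (n - 1)).map delta

/-- The term `E_{1,r}^{s,q} = Z_r^s / (Z_{r-1}^{s+1} + δ Z_{r-1}^{s-r+1})`, in total degree `s + q`,
of the spectral sequence of the first filtration. -/
abbrev Page (r s q : ℤ) : Type _ :=
  ↥(ZPage E M G r s (s + q)) ⧸ (BPage E M G r s (s + q)).submoduleOf (ZPage E M G r s (s + q))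

variable {E M G}

theorem delta_mem_Tot {n : ℤ} {c : Cochain E M G} (hc : c ∈ Tot E M G n) :
    delta c ∈ Tot E M G (n + 1) := by
  intro p q h
  have h1 : delta' c p q = 0 := by
    cases p with
    | zero => rfl
    | succ p =>
      have h0 : c p q = 0 := hc p q (by push_cast at h; omega)
      change D (formRep E M G q) p (c p q) = 0
      rw [h0, map_zero]
  have h2 : delta'' c p q = 0 := by
    cases q with
    | zero => rfl
    | succ q =>
      have h0 : c p q = 0 := hc p q (by push_cast at h; omega)
      funext g
      change (-1 : ℝ) ^ p • d (c p q g) = 0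
      rw [h0]
      simp
  change delta' c p q + delta'' c p q = 0
  rw [h1, h2, add_zero]

theorem Tot_inf_Fil_eq_zero {n s : ℤ} (h : n < s) {c : Cochain E M G} (hc : c ∈ Tot E M G n)
    (hc' : c ∈ Fil E M G s) : c = 0 := by
  funext p q
  by_cases hp : (p : ℤ) < s
  · exact hc' p q hp
  · exact hc p q (by omega)

/-- Beyond the last page with a nonzero outgoing differential, elements of `Z_r^s` are cocycles. -/
theorem delta_eq_zero_of_mem_ZPage {r s n : ℤ} (h : n + 1 < s + r) {c : Cochain E M G}
    (hc : c ∈ ZPage E M G r s n) : delta c = 0 :=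
  Tot_inf_Fil_eq_zero h (delta_mem_Tot hc.1.1) hc.2

/-- For `r > q + 1` the natural homomorphism `E_{1,r}^{s,q} → E_{1,∞}^{s,q} = Im h_s / Im h_{s+1}`
(in degree `n = s + q`), which sends the class of a cochain `z ∈ Z_r^s` (which is a cocycle, since
`δ z ∈ F_{1,s+r}` has degree `n + 1 < s + r`) to the class of `z`. -/
def pageToGraded {r s q n : ℤ} (hn : s + q = n) (hr : q + 1 < r) :
    Page E M G r s q →ₗ[ℝ] GradedPiece E M G s n :=
  Submodule.liftQ _
    ((Submodule.mkQ _) ∘ₗ (LinearMap.rangeRestrict (hFil E M G s n)) ∘ₗ (Submodule.mkQ _) ∘ₗ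
      (Submodule.inclusion (p := ZPage E M G r s (s + q)) (p' := cocycles (Fil E M G s) n)
        (fun z hz => ⟨by rw [← hn]; exact hz.1, delta_eq_zero_of_mem_ZPage (by omega) hz⟩)))
    (by
      subst hn
      rintro ⟨z, hz⟩ hzB
      obtain ⟨y, hy, w, ⟨v, hv, rfl⟩, hyw⟩ := Submodule.mem_sup.1
        (show z ∈ BPage E M G r s (s + q) from hzB)
      have hy0 : delta y = 0 := delta_eq_zero_of_mem_ZPage (by omega) hy
      have hzc : z ∈ cocycles (⊤ : Submodule ℝ (Cochain E M G)) (s + q) :=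
        ⟨⟨hz.1.1, trivial⟩, delta_eq_zero_of_mem_ZPage (by omega) hz⟩
      have hyc : y ∈ cocycles (⊤ : Submodule ℝ (Cochain E M G)) (s + q) :=
        ⟨⟨hy.1.1, trivial⟩, hy0⟩
      rw [LinearMap.mem_ker]
      refine (Submodule.Quotient.mk_eq_zero _).2 ?_
      refine ⟨Submodule.Quotient.mk ⟨y, hy.1, hy0⟩, ?_⟩
      refine (Submodule.Quotient.eq _).2 ?_
      change y - z ∈ coboundaries (⊤ : Submodule ℝ (Cochain E M G)) (s + q)
      refine ⟨-v, ⟨neg_mem hv.1.1, trivial⟩, ?_⟩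
      rw [map_neg, ← hyw]
      abel)

/-- A form `α ∈ Ω^m(M)` as the element of `C^0(G, Ω^m(M)) ⊆ C^{**}(G, Ω(M))`. -/
def inclForm {m : ℕ} (α : Form E M m) : Cochain E M G := Pi.single 0 (Pi.single m fun _ => α)

variable (G) in
/-- A form is `G`-invariant if `g^* α = α` for all `g ∈ G`. -/
def IsInvariant {m : ℕ} (α : Form E M m) : Prop :=
  ∀ g : G, formRep E M G m (MulOpposite.op g) α = α

theorem inclForm_mem_cocycles {m : ℕ} {α : Form E M m} (hinv : IsInvariant G α)
    (hd : d α = 0) :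
    (inclForm α : Cochain E M G) ∈ cocycles (⊤ : Submodule ℝ (Cochain E M G)) (m : ℤ) := by
  have hpos : ∀ p q : ℕ, ¬(p = 0 ∧ q = m) → (inclForm α : Cochain E M G) p q = 0 := by
    intro p q h
    by_cases hp : p = 0
    · subst hp
      have hq : q ≠ m := fun hq => h ⟨rfl, hq⟩
      simp [inclForm, hq]
    · simp [inclForm, hp]
  have hval : (inclForm α : Cochain E M G) 0 m = fun _ => α := by simp [inclForm]
  refine ⟨⟨fun p q h => hpos p q (by rintro ⟨rfl, rfl⟩; simp at h), trivial⟩, ?_⟩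
  change delta (inclForm α : Cochain E M G) = 0
  funext p q
  have h1 : delta' (inclForm α : Cochain E M G) p q = 0 := by
    cases p with
    | zero => rfl
    | succ p =>
      change D (formRep E M G q) p ((inclForm α : Cochain E M G) p q) = 0
      by_cases h : p = 0 ∧ q = m
      · obtain ⟨rfl, rfl⟩ := h
        rw [hval]
        funext g
        simp [D, hinv (g 0)]
      · rw [hpos p q h, map_zero]
  have h2 : delta'' (inclForm α : Cochain E M G) p q = 0 := by
    cases q with
    | zero => rfl
    | succ q =>
      funext g
      change (-1 : ℝ) ^ p • d ((inclForm α : Cochain E M G) p q g) = 0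
      by_cases h : p = 0 ∧ q = m
      · obtain ⟨rfl, rfl⟩ := h
        rw [hval, hd, smul_zero]
      · rw [hpos p q h]
        simp
  change delta' (inclForm α : Cochain E M G) p q + delta'' (inclForm α : Cochain E M G) p q = 0
  rw [h1, h2, add_zero]

/-- The class `h(α) ∈ H^m(G, M, Ω(M))` of a closed `G`-invariant form `α`. -/
def hClass {m : ℕ} (α : Form E M m) (hinv : IsInvariant G α) (hd : d α = 0) :
    TotalCohomology E M G m :=
  Submodule.Quotient.mk ⟨inclForm α, inclForm_mem_cocycles hinv hd⟩

variable (E M G) in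
/-- Real-valued cochains on `G` as cochains with values in the constant functions on `M`. -/
def inclConst (m : ℕ) : ((Fin m → G) → ℝ) →ₗ[ℝ] Cochain E M G where
  toFun f := Pi.single m (Pi.single 0 fun g => constForm (f g))
  map_add' f f' := by
    rw [← Pi.single_add, ← Pi.single_add]
    congr 2
  map_smul' a f := by
    rw [RingHom.id_apply, ← Pi.single_smul, ← Pi.single_smul]
    congr 2

theorem inclConst_apply_of_ne {m : ℕ} (f : (Fin m → G) → ℝ) {p q : ℕ} (h : ¬(p = m ∧ q = 0)) :
    inclConst E M G m f p q = 0 := by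
  by_cases hp : p = m
  · subst hp
    have hq : q ≠ 0 := fun hq => h ⟨rfl, hq⟩
    simp [inclConst, hq]
  · simp [inclConst, hp]

theorem inclConst_apply_self {m : ℕ} (f : (Fin m → G) → ℝ) :
    inclConst E M G m f m 0 = fun g => constForm (f g) := by
  simp [inclConst]

theorem D_constForm {m : ℕ} (f : (Fin m → G) → ℝ) :
    D (formRep E M G 0) m (fun g => constForm (f g)) =
      fun g => constForm (D (Representation.trivial ℝ Gᵐᵒᵖ ℝ) m f g) := by
  funext g
  have h : ∀ (x : Gᵐᵒᵖ) (c : ℝ), formRep E M G 0 x (constForm c) = constForm c := fun _ _ => rfl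
  simp only [D, LinearMap.coe_mk, AddHom.coe_mk, h, map_add, map_sum, map_smul,
    Representation.trivial_apply]

theorem delta_inclConst {m : ℕ} (f : (Fin m → G) → ℝ) :
    delta (inclConst E M G m f) =
      inclConst E M G (m + 1) (D (Representation.trivial ℝ Gᵐᵒᵖ ℝ) m f) := by
  funext p q
  have h2 : delta'' (inclConst E M G m f) p q = 0 := by
    cases q with
    | zero => rfl
    | succ q =>
      funext g
      change (-1 : ℝ) ^ p • d (inclConst E M G m f p q g) = 0
      by_cases h : p = m ∧ q = 0
      · obtain ⟨rfl, rfl⟩ := h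
        rw [inclConst_apply_self, d_constForm, smul_zero]
      · rw [inclConst_apply_of_ne f h]
        simp
  change delta' (inclConst E M G m f) p q + delta'' (inclConst E M G m f) p q = _
  rw [h2, add_zero]
  cases p with
  | zero =>
    rw [inclConst_apply_of_ne _ (by omega)]
    rfl
  | succ p =>
    change D (formRep E M G q) p (inclConst E M G m f p q) = _
    by_cases h : p = m ∧ q = 0
    · obtain ⟨rfl, rfl⟩ := h
      rw [inclConst_apply_self, inclConst_apply_self, D_constForm]
    · rw [inclConst_apply_of_ne f h, map_zero, inclConst_apply_of_ne _ (by omega)]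

theorem inclConst_mem {m : ℕ} {s n : ℤ} (hs : s = m) (hn : n = m) (f : (Fin m → G) → ℝ) :
    inclConst E M G m f ∈ Tot E M G n ⊓ Fil E M G s :=
  ⟨fun _ _ h => inclConst_apply_of_ne f (by rintro ⟨rfl, rfl⟩; simp [hn] at h),
    fun _ _ h => inclConst_apply_of_ne f (by rintro ⟨rfl, rfl⟩; omega)⟩

variable (E M G) in
/-- The natural homomorphism `H^s(G, ℝ) → H^s(G, H^0(M)) = E_{1,2}^{s,0}`, `ℝ` being the trivial
`G`-module, which regards real numbers as constant functions on `M`. -/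
def groupCohomologyToPage {m : ℕ} {s : ℤ} (hs : s = m) :
    GroupCohomology (Representation.trivial ℝ Gᵐᵒᵖ ℝ) m →ₗ[ℝ] Page E M G 2 s 0 :=
  Submodule.mapQ _ _
    ((inclConst E M G m).restrict (p := LinearMap.ker (D (Representation.trivial ℝ Gᵐᵒᵖ ℝ) m))
      (q := ZPage E M G 2 s (s + 0)) (fun f hf => by
        refine ⟨inclConst_mem hs (by omega) f, ?_⟩
        change delta (inclConst E M G m f) ∈ Fil E M G (s + 2)
        rw [delta_inclConst, LinearMap.mem_ker.1 hf, map_zero]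
        exact zero_mem _))
    (by
      rintro ⟨f, hf⟩ hfB
      change inclConst E M G m f ∈ BPage E M G 2 s (s + 0)
      have hfB' : f ∈ groupCoboundaries (Representation.trivial ℝ Gᵐᵒᵖ ℝ) m := hfB
      cases m with
      | zero =>
        rw [(Submodule.mem_bot ℝ).1 hfB', map_zero]
        exact zero_mem _
      | succ m =>
        obtain ⟨b, rfl⟩ := hfB'
        rw [← delta_inclConst]
        refine Submodule.mem_sup_right (Submodule.mem_map_of_mem ⟨?_, ?_⟩)
        · exact inclConst_mem (by push_cast at hs; omega) (by push_cast at hs; omega) b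
        · change delta (inclConst E M G m b) ∈ Fil E M G (s - 2 + 1 + (2 - 1))
          rw [delta_inclConst]
          exact (inclConst_mem (n := s) (by omega) hs _).2)

end DoubleComplex
end GManifold
end

/-! Both parts rest on reading the terms of the spectral sequence directly from cochains; no
convergence argument is needed.

Surjectivity of `κ_r` is immediate (`pageToGraded_surjective`): a class in `Im h_s` is represented
by a cocycle of `F_s`, and a cocycle lies in `Z_r^s` for every `r`. The statements that `h(ω)` has a
representative in the page are then just surjectivity applied to its image.

For injectivity (`pageToGraded_injective`), let `z ∈ Z_r^s` have class zero in `Im h_s / Im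
h_{s+1}`. Then `z` differs from a cocycle `y ∈ F_{s+1}` by a coboundary `δv`, where `v` is only
known to lie in the whole complex. If `s - r + 1 ≤ 0`, the whole complex is `F_{s-r+1}`, so `v ∈
Z_{r-1}^{s-r+1}` and `z` is zero in the page already. With `s = p + 1` and `r = m - p + 1` the
condition reads `2p - m + 1 ≤ 0`, that is `2p < m`.

When `m = p + 1` the page is `E_2^{m,0}`. A cochain of degree `m` in `F_m` has the single bidegree
`(m, 0)`, and its component of `δ` in bidegree `(m, 1)` is `±d`. Hence an element of `Z_2^m` takes
values in closed functions, which on a connected manifold are constants. The same holds for the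
cochains of degree `m - 1` whose coboundaries are divided out, so cocycles and coboundaries are
those of real group cohomology. -/

namespace GManifold

/-! ### Closed functions and constants -/

section Constants
variable {E : Type*} [NormedAddCommGroup E] [NormedSpace ℝ E]
  {M : Type*} [TopologicalSpace M] [ChartedSpace E M] [IsManifold 𝓘(ℝ, E) ∞ M]

/-- A closed `0`-form is a locally constant function. -/
theorem isLocallyConstant_of_d_eq_zero {f : Form E M 0} (hf : d f = 0) :
    IsLocallyConstant fun x : M => f.1 x 0 := by
  intro s
  refine isOpen_iff_mem_nhds.2 fun x hx => ?_
  set e := chartAt E x with he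
  let φ : E → ℝ := fun y => pull e.symm f.1 y 0
  have hs : ∀ y ∈ e.target, ContMDiffAt 𝓘(ℝ, E) 𝓘(ℝ, E) ∞ e.symm y :=
    fun y hy => contMDiffAt_symm_of_mem_atlas (chart_mem_atlas E x) hy
  have hpull : ∀ y ∈ e.target, DifferentiableAt ℝ (pull e.symm f.1) y :=
    fun y hy => (contDiffAt_pull (hs y hy) f.2).differentiableAt (by simp)
  -- An alternating form in zero variables is a scalar, so the exterior derivative of the coordinate
  -- expression becomes the Fréchet derivative of `φ`.
  have hconst : pull e.symm f.1 =
      fun y => ContinuousAlternatingMap.constOfIsEmpty ℝ E (Fin 0) (φ y) := by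
    funext y
    ext v
    rw [Subsingleton.elim v 0]
    rfl
  have hφ : DifferentiableOn ℝ φ e.target := fun y hy =>
    (((ContinuousAlternatingMap.constOfIsEmptyLIE ℝ E ℝ (Fin 0)).symm.differentiable _).comp y
      (hpull y hy)).differentiableWithinAt
  have hφ' : e.target.EqOn (fderiv ℝ φ) 0 := by
    intro y hy
    have h1 : extDeriv (pull e.symm f.1) y = 0 := by
      rw [extDeriv_pull (hs y hy) f.2, show dField f.1 = 0 from congrArg Subtype.val hf]
      rfl
    rw [hconst, extDeriv_constOfIsEmpty] at h1
    ext v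
    simpa using congrArg (fun T => T fun _ => v) h1
  -- A function with zero derivative on an open set has open preimages of arbitrary sets there.
  -- Applied on all of `e.target`, this avoids shrinking to a ball; the chart carries the open set
  -- back to `M`.
  have hopen := e.isOpen_inter_preimage
    (e.open_target.isOpen_inter_preimage_of_fderiv_eq_zero hφ hφ' s)
  have hval : ∀ z ∈ e.source, φ (e z) = f.1 z 0 := by
    intro z hz
    change f.1 (e.symm (e z)) _ = _
    rw [e.left_inv hz]
    exact congrArg (f.1 z) (Subsingleton.elim _ _)
  filter_upwards [hopen.mem_nhds ⟨mem_chart_source E x, mem_chart_target E x,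
    show φ (e x) ∈ s by rwa [hval x (mem_chart_source E x)]⟩] with z hz
  change f.1 z 0 ∈ s
  rw [← hval z hz.1]
  exact hz.2.2

/-- Connectedness turns locally constant into constant, and nonemptiness supplies a point at which
to read off the value. -/
theorem exists_constForm_eq [ConnectedSpace M] {f : Form E M 0} (hf : d f = 0) :
    ∃ c : ℝ, constForm c = f := by
  obtain ⟨x₀⟩ := (inferInstance : Nonempty M)
  refine ⟨f.1 x₀ 0, Subtype.ext (funext fun x => ?_)⟩
  ext v
  rw [Subsingleton.elim v 0]
  exact ((isLocallyConstant_of_d_eq_zero hf).apply_eq_of_isPreconnected isPreconnected_univ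
    (Set.mem_univ x) (Set.mem_univ x₀)).symm

theorem constForm_injective [Nonempty M] :
    Function.Injective (constForm : ℝ →ₗ[ℝ] Form E M 0) := by
  intro a b h
  obtain ⟨x⟩ := ‹Nonempty M›
  exact congrArg (fun f : Form E M 0 => f.1 x 0) h

end Constants

/-! ### From the pages to the graded pieces of total cohomology -/

section Pages
variable {E : Type*} [NormedAddCommGroup E] [NormedSpace ℝ E]
  {M : Type*} [TopologicalSpace M] [ChartedSpace E M] [IsManifold 𝓘(ℝ, E) ∞ M]
  {G : Type*} [Group G] [MulAction G M] [SmoothAction E M G]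

theorem mem_Fil_of_nonpos {s : ℤ} (hs : s ≤ 0) (c : Cochain E M G) : c ∈ Fil E M G s :=
  fun _ _ h => by omega

/-- Classes in `Im h_s` come from honest cocycles of `F_s`, and zero lies in every `F_{s+r}`; the
cocycle itself is the preimage. -/
theorem pageToGraded_surjective {r s q n : ℤ} (hn : s + q = n) (hr : q + 1 < r) :
    Function.Surjective (pageToGraded hn hr : Page E M G r s q →ₗ[ℝ] GradedPiece E M G s n) := by
  subst hn
  intro y
  obtain ⟨⟨y, hy⟩, rfl⟩ := Submodule.Quotient.mk_surjective _ y
  obtain ⟨z, rfl⟩ := hy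
  obtain ⟨⟨z, hz⟩, rfl⟩ := Submodule.Quotient.mk_surjective _ z
  refine ⟨Submodule.Quotient.mk ⟨z, hz.1, ?_⟩, rfl⟩
  change delta z ∈ Fil E M G (s + r)
  rw [LinearMap.mem_ker.1 hz.2]
  exact zero_mem _

/-- If no differential arriving at `E_r^{s,q}` can be nonzero, then `κ_r` is injective. -/
theorem pageToGraded_injective {r s q n : ℤ} (hn : s + q = n) (hr : q + 1 < r)
    (hs : s - r + 1 ≤ 0) :
    Function.Injective (pageToGraded hn hr : Page E M G r s q →ₗ[ℝ] GradedPiece E M G s n) := by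
  subst hn
  rw [injective_iff_map_eq_zero]
  intro x hx
  obtain ⟨⟨z, hz⟩, rfl⟩ := Submodule.Quotient.mk_surjective _ x
  obtain ⟨y, hy⟩ := (Submodule.Quotient.mk_eq_zero _).1 hx
  obtain ⟨⟨y, hyc⟩, rfl⟩ := Submodule.Quotient.mk_surjective _ y
  -- The classes of `y ∈ F_{s+1}` and `z` agree in the total cohomology, so the primitive of `y - z`
  -- carries no filtration bound.
  have hyz : y - z ∈ coboundaries (⊤ : Submodule ℝ (Cochain E M G)) (s + q) :=
    (Submodule.Quotient.eq ((coboundaries (⊤ : Submodule ℝ (Cochain E M G)) (s + q)).submoduleOf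
      (cocycles ⊤ (s + q))) (x := ⟨y, ⟨hyc.1.1, trivial⟩, hyc.2⟩)
      (y := ⟨z, ⟨hz.1.1, trivial⟩, delta_eq_zero_of_mem_ZPage (by omega) hz⟩)).1 hy
  obtain ⟨v, hv, hvyz⟩ := hyz
  have hδy : delta y = 0 := hyc.2
  refine (Submodule.Quotient.mk_eq_zero _).2 ?_
  -- The decomposition `z = y + δ(-v)`, with `y ∈ Z_{r-1}^{s+1}` and `-v ∈ Z_{r-1}^{s-r+1}`. The
  -- assumption `s - r + 1 ≤ 0` enters only to place `v` in the filtration.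
  refine Submodule.mem_sup.2 ⟨y, ⟨hyc.1, ?_⟩, delta (-v),
    Submodule.mem_map_of_mem ⟨⟨neg_mem hv.1, mem_Fil_of_nonpos hs _⟩, ?_⟩, ?_⟩
  · change delta y ∈ Fil E M G (s + 1 + (r - 1))
    rw [hδy]
    exact zero_mem _
  · change delta (-v) ∈ Fil E M G (s - r + 1 + (r - 1))
    -- Here `δ(-v) = z - y`, and both terms lie in `F_s`.
    rw [map_neg, hvyz, neg_sub, show s - r + 1 + (r - 1) = s by ring]
    exact sub_mem hz.1.2 fun a b h => hyc.1.2 a b (by omega)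
  · change y + delta (-v) = z
    rw [map_neg, hvyz]
    abel

/-! ### The bottom row of the second page and real group cohomology -/

/-- A cochain concentrated in bidegree `(m, 0)` with values in closed functions on a connected
manifold is real-valued. -/
theorem exists_inclConst_eq [ConnectedSpace M] {m : ℕ} {s : ℤ} (hs : s = m) {c : Cochain E M G}
    (hc : c ∈ Tot E M G s ⊓ Fil E M G s) (hδ : delta c ∈ Fil E M G (s + 1)) :
    ∃ f, inclConst E M G m f = c := by
  have hne : ∀ a b : ℕ, ¬(a = m ∧ b = 0) → c a b = 0 := by
    intro a b h
    by_cases ha : (a : ℤ) < s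
    · exact hc.2 a b ha
    · exact hc.1 a b (by omega)
  have hd : ∀ g, d (c m 0 g) = 0 := by
    intro g
    -- Bidegree `(m, 1)` isolates the vertical differential: the horizontal contribution would come
    -- from `c` in bidegree `(m - 1, 1)`, where `c` vanishes.
    have h1 : delta' c m 1 + delta'' c m 1 = 0 := hδ m 1 (by omega)
    have h2 : delta' c m 1 = 0 := by
      cases m with
      | zero => rfl
      | succ k =>
        change D (formRep E M G 1) k (c k 1) = 0
        rw [hne k 1 (by omega), map_zero]
    rw [h2, zero_add] at h1
    have h3 : (-1 : ℝ) ^ m • d (c m 0 g) = 0 := congrFun h1 g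
    exact (smul_eq_zero.1 h3).resolve_left (pow_ne_zero _ (by norm_num))
  choose f hf using fun g => exists_constForm_eq (hd g)
  refine ⟨f, funext fun a => funext fun b => ?_⟩
  by_cases h : a = m ∧ b = 0
  · obtain ⟨rfl, rfl⟩ := h
    rw [inclConst_apply_self]
    exact funext hf
  · rw [inclConst_apply_of_ne f h, hne a b h]

theorem inclConst_injective [Nonempty M] (m : ℕ) : Function.Injective (inclConst E M G m) := by
  intro f f' h
  have h1 := congrFun (congrFun h m) 0
  rw [inclConst_apply_self, inclConst_apply_self] at h1
  exact funext fun g => constForm_injective (congrFun h1 g)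

/-- In degree `s`, an element of `Z_2^s` is a cocycle for degree reasons, hence real-valued; since
`inclConst` intertwines `D` and `δ` and is injective, the underlying real cochain is a group
cocycle. -/
theorem groupCohomologyToPage_surjective [ConnectedSpace M] {m : ℕ} {s : ℤ} (hs : s = m) :
    Function.Surjective (groupCohomologyToPage E M G hs) := by
  intro x
  obtain ⟨⟨z, hz⟩, rfl⟩ := Submodule.Quotient.mk_surjective _ x
  have hδ : delta z = 0 := delta_eq_zero_of_mem_ZPage (by omega) hz
  obtain ⟨f, rfl⟩ := exists_inclConst_eq hs (show z ∈ Tot E M G s ⊓ Fil E M G s by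
      have h := hz.1
      rwa [add_zero] at h)
    (by rw [hδ]; exact zero_mem _)
  have hf : D (Representation.trivial ℝ Gᵐᵒᵖ ℝ) m f = 0 := by
    apply inclConst_injective (E := E) (M := M) (G := G) (m + 1)
    rw [← delta_inclConst, hδ, map_zero]
  exact ⟨Submodule.Quotient.mk ⟨f, hf⟩, rfl⟩

/-- Of the two summands divided out in the page, `Z_1^{s+1}` is zero in degree `s`, and `Z_1^{s-1}`
in degree `s - 1` consists of real-valued cochains. Thus only coboundaries of real cochains are
killed. -/
theorem groupCohomologyToPage_injective [ConnectedSpace M] {m : ℕ} {s : ℤ} (hs : s = m) :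
    Function.Injective (groupCohomologyToPage E M G hs) := by
  rw [injective_iff_map_eq_zero]
  intro x hx
  obtain ⟨⟨f, hf⟩, rfl⟩ := Submodule.Quotient.mk_surjective _ x
  have hZ : inclConst E M G m f ∈ ZPage E M G 2 s (s + 0) := by
    refine ⟨inclConst_mem hs (by omega) f, ?_⟩
    change delta (inclConst E M G m f) ∈ Fil E M G (s + 2)
    rw [delta_inclConst, LinearMap.mem_ker.1 hf, map_zero]
    exact zero_mem _
  have hx' : (Submodule.Quotient.mk ⟨inclConst E M G m f, hZ⟩ : Page E M G 2 s 0) = 0 := hx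
  have hfB : inclConst E M G m f ∈ BPage E M G 2 s (s + 0) :=
    (Submodule.Quotient.mk_eq_zero
      ((BPage E M G 2 s (s + 0)).submoduleOf (ZPage E M G 2 s (s + 0)))).1 hx'
  obtain ⟨y, hy, w, ⟨v, hv, rfl⟩, hyv⟩ := Submodule.mem_sup.1 hfB
  -- `y` has degree `s` but lies in `F_{s+1}`, so it vanishes.
  rw [Tot_inf_Fil_eq_zero (by omega) hy.1.1 hy.1.2, zero_add] at hyv
  refine (Submodule.Quotient.mk_eq_zero _).2 ?_
  change f ∈ groupCoboundaries (Representation.trivial ℝ Gᵐᵒᵖ ℝ) m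
  cases m with
  | zero =>
    -- For `m = 0` the cochain `v` has degree `-1`, which matches the convention that there are no
    -- coboundaries in degree zero.
    have hv0 : v = 0 := funext fun a => funext fun b => hv.1.1 a b (by push_cast at hs; omega)
    rw [hv0, map_zero] at hyv
    refine (Submodule.mem_bot ℝ).2 (inclConst_injective (E := E) (M := M) (G := G) 0 ?_)
    rw [← hyv, map_zero]
  | succ k =>
    have hk : s - 2 + 1 = k := by push_cast at hs; omega
    -- The condition `δv ∈ F_s` with `v` of degree `s - 1` in `F_{s-1}` is what forces `v` to be
    -- real-valued.
    obtain ⟨b, rfl⟩ := exists_inclConst_eq hk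
      ⟨by rw [show s - 2 + 1 = s + 0 - 1 by ring]; exact hv.1.1, hv.1.2⟩ hv.2
    refine ⟨b, inclConst_injective (E := E) (M := M) (G := G) (k + 1) ?_⟩
    rw [← delta_inclConst, hyv]

end Pages
end GManifold

/-! ### The main theorem -/

theorem mainTheorem10
    {E : Type*} [NormedAddCommGroup E] [NormedSpace ℝ E] [FiniteDimensional ℝ E]
    {M : Type*} [TopologicalSpace M] [ChartedSpace E M] [IsManifold 𝓘(ℝ, E) ∞ M]
    {G : Type*} [Group G] [MulAction G M] [GManifold.SmoothAction E M G]
    (m : ℕ) (α : GManifold.Form E M m)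
    (hinv : GManifold.IsInvariant G α) (hex : GManifold.IsExact α) (p : ℤ)
    (hp : IsGreatest
      {k : ℤ | GManifold.hClass α hinv hex.d_eq_zero ∈ GManifold.ImH E M G (k + 1) m} p) :
    (let κ : GManifold.Page E M G (m - p + 1) (p + 1) (m - p - 1) →ₗ[ℝ]
          GManifold.GradedPiece E M G (p + 1) m := GManifold.pageToGraded (by omega) (by omega)
     Function.Surjective κ ∧
     (2 * p < m → Function.Injective κ) ∧
     ∃ e, κ e = GManifold.toGraded (GManifold.hClass α hinv hex.d_eq_zero) hp.1) ∧
    (∀ hm : (m : ℤ) = p + 1, ConnectedSpace M →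
      let κ : GManifold.Page E M G 2 (p + 1) 0 →ₗ[ℝ]
          GManifold.GradedPiece E M G (p + 1) m := GManifold.pageToGraded (by omega) (by omega)
      let ι : GManifold.GroupCohomology (Representation.trivial ℝ Gᵐᵒᵖ ℝ) m →ₗ[ℝ]
          GManifold.Page E M G 2 (p + 1) 0 := GManifold.groupCohomologyToPage E M G hm.symm
      Function.Bijective ι ∧
      ∃ c, κ (ι c) = GManifold.toGraded (GManifold.hClass α hinv hex.d_eq_zero) hp.1) := by
  -- Kept general in `r` and `q`: it serves both the page `m - p + 1` and, when `m = p + 1`, the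
  -- second page with `q = 0`.
  have hsurj := fun (r q : ℤ) (hn : p + 1 + q = m) (hr : q + 1 < r) =>
    GManifold.pageToGraded_surjective (E := E) (M := M) (G := G) hn hr
  refine ⟨⟨hsurj _ _ _ _, fun h => GManifold.pageToGraded_injective _ _ (by omega),
    hsurj _ _ _ _ _⟩, fun hm _ => ?_⟩
  have hι := GManifold.groupCohomologyToPage_surjective (E := E) (M := M) (G := G) hm.symm
  refine ⟨⟨GManifold.groupCohomologyToPage_injective hm.symm, hι⟩, ?_⟩
  -- The composite from group cohomology is surjective, so the image of `h(ω)` has a preimage.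
  exact ((hsurj 2 0 (by omega) (by omega)).comp hι) _
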